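/- A graph $\Gamma$ here consists of a set $V_\Gamma$ of vertices, a set $E_\Gamma$ of edges, maps $s,t\colon E_\Gamma\to V_\Gamma$ (source and target) and a weight $w\colon E_\Gamma\to\mathbb{Z}_{>0}$; loops and multiple edges are allowed. A walk from $x$ to $y$ is a sequence of edges $e_1\cdots e_\ell$ with $s(e_1)=x$, $t(e_\ell)=y$ and $t(e_j)=s(e_{j+1})$ for $1\le j<\ell$, or the trivial walk of length $0$ if $x=y$; its weight is $\sum_j w(e_j)$. Let $d_\Gamma(x,y)\in\mathbb{Z}_{\ge 0}\cup\{\infty\}$ be the smallest weight of a walk from $x$ to $y$, and $\infty$ if there is none. Let $n\ge 1$. An $n$-dimensional periodic graph $(\Gamma,L)$ is a graph $\Gamma$ together with a free abelian group $L\simeq\mathbb{Z}^n$ that acts freely on both $V_\Gamma$ and $E_\Gamma$, with finite quotients $V_\Gamma/L$ and $E_\Gamma/L$, such that $s(u+e)=u+s(e)$, $t(u+e)=u+t(e)$ and $w(u+e)=w(e)$ for all $u\in L$ and $e\in E_\Gamma$. A function $f\colon\mathbb{Z}\to\mathbb{C}$ is a quasi-polynomial if there are an integer $N\ge 1$ and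 polynomials $Q_0,\dots,Q_{N-1}\in\mathbb{C}[x]$ such that $f(m)=Q_j(m)$ whenever $m\equiv j \pmod N$. A function $g\colon\mathbb{Z}_{\ge 0}\to\mathbb{C}$ is of quasi-polynomial type if there are an integer $M\ge 0$ and a quasi-polynomial $f$ with $g(m)=f(m)$ for all $m>M$. **Theorem.** Let $(\Gamma,L)$ be an $n$-dimensional periodic graph, and let $U\subset V_\Gamma$ be a finite subset. Then for every $i\in\mathbb{Z}_{\ge 0}$ the set $\{y\in V_\Gamma \mid \min_{x\in U} d_\Gamma(x,y)\le i\}$ is finite, and the function $$\mathbb{Z}_{\ge 0}\to\mathbb{Z}_{\ge 0};\quad i\mapsto \#\Bigl\{y\in V_\Gamma \Bigm| \min_{x\in U} d_\Gamma(x,y)\le i\Bigr\}$$ is of quasi-polynomial type. (The minimum over the empty set is $\infty$.) -/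

import Mathlib

/-- A directed weighted graph with vertex set `V` and edge set `E`, possibly with loops and
multiple edges; the weights of the edges are positive integers. -/
structure WeightedDigraph (V E : Type*) where
  /-- the source of an edge -/
  src : E → V
  /-- the target of an edge -/
  tgt : E → V
  /-- the weight of an edge -/
  weight : E → ℕ
  weight_pos : ∀ e, 0 < weight e

namespace WeightedDigraph

variable {V E : Type*}

/-- `Γ.IsWalk x y p` says that the sequence of edges `p` is a walk from `x` to `y` in `Γ`.
The empty sequence is the trivial walk from `x` to `x`. -/
def IsWalk (Γ : WeightedDigraph V E) (x y : V) : List E → Prop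
  | [] => x = y
  | e :: p => Γ.src e = x ∧ Γ.IsWalk (Γ.tgt e) y p

/-- The weight of a sequence of edges: the sum of the weights of its members. -/
def walkWeight (Γ : WeightedDigraph V E) (p : List E) : ℕ :=
  (p.map Γ.weight).sum

/-- `Γ.dist x y` is the smallest weight of a walk from `x` to `y`; it is `⊤` if there is no
such walk. -/
noncomputable def dist (Γ : WeightedDigraph V E) (x y : V) : ℕ∞ :=
  ⨅ (p : List E) (_ : Γ.IsWalk x y p), (Γ.walkWeight p : ℕ∞)

/-- `(Γ, L)` is an `n`-dimensional periodic graph, for the given actions of the additive group `L`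
on the vertices and on the edges of `Γ`. -/
structure IsPeriodic (Γ : WeightedDigraph V E) (L : Type*) [AddCommGroup L]
    [AddAction L V] [AddAction L E] (n : ℕ) : Prop where
  dim_pos : 0 < n
  lattice : Nonempty (L ≃+ (Fin n → ℤ))
  free_vertices : ∀ (u : L) (x : V), u +ᵥ x = x → u = 0
  free_edges : ∀ (u : L) (e : E), u +ᵥ e = e → u = 0
  finite_vertices : Finite (AddAction.orbitRel.Quotient L V)
  finite_edges : Finite (AddAction.orbitRel.Quotient L E)
  src_vadd : ∀ (u : L) (e : E), Γ.src (u +ᵥ e) = u +ᵥ Γ.src e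
  tgt_vadd : ∀ (u : L) (e : E), Γ.tgt (u +ᵥ e) = u +ᵥ Γ.tgt e
  weight_vadd : ∀ (u : L) (e : E), Γ.weight (u +ᵥ e) = Γ.weight e

/-- The vertices `y` with `min_{x ∈ U} d(x, y) ≤ i`. The minimum over the empty set is `⊤`. -/
def ballAround (Γ : WeightedDigraph V E) (U : Finset V) (i : ℕ) : Set V :=
  {y | (⨅ x ∈ U, Γ.dist x y) ≤ (i : ℕ∞)}

end WeightedDigraph

/-- A function `f : ℤ → ℂ` is a quasi-polynomial if it agrees with a polynomial on each residue
class modulo some positive integer `N`. -/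
def IsQuasiPolynomial (f : ℤ → ℂ) : Prop :=
  ∃ (N : ℕ) (_ : 0 < N) (Q : Fin N → Polynomial ℂ),
    ∀ (n : ℤ) (i : Fin N), n ≡ ((i : ℕ) : ℤ) [ZMOD (N : ℤ)] → f n = (Q i).eval (n : ℂ)

/-- A function on the non-negative integers is of quasi-polynomial type if it agrees with a
quasi-polynomial at all sufficiently large integers. -/
def IsQuasiPolynomialType (g : ℕ → ℂ) : Prop :=
  ∃ (M : ℕ) (f : ℤ → ℂ), IsQuasiPolynomial f ∧ ∀ n : ℕ, M < n → g n = f (n : ℤ)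

/-!
Fix representatives of the vertex orbits and encode a vertex `u +ᵥ q.out` with a time bound `i` as
the orbit `q` together with the element `(u, i)` of the commutative monoid `L × ℕ`. The pairs
`(y, i)` for which `y` lies in the ball of radius `i` are then the least solution of a finite linear
system with finite coefficients: add the label of an edge, or let one unit of time pass. Because the
monoid is commutative, eliminating the orbits one at a time shows that the solution is semilinear.

A semilinear set with finitely many elements of each degree is a finite union of hybrid linear sets
`F + N`, with `F` finite and `N` a finitely generated monoid of periods of positive degree. These
are stable under intersection, so inclusion-exclusion reduces the count to a single `F + N`, and
adding the points of `F` one by one reduces it further to the part of a translate `b +ᵥ N` outside a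
set closed under adding periods. In lexicographically minimal coordinates this part is the
complement of an upper set of `ι → ℕ`, and by Dickson's lemma an upper set is a finite union of
orthants. A translation by a vector of degree `d` multiplies the counting sequence by the `d`-th
power of the shift, so the counting sequence of an orthant is annihilated by a product of
polynomials `X ^ d - 1`, and hence is eventually a quasi-polynomial.
-/

open Polynomial
open scoped Pointwise

section SequenceShift

variable (G : Type*) [AddCommGroup G]

/-- The shift operator `f ↦ f (· + 1)` on sequences with values in `G`; integer polynomials act on
sequences through it. -/
def seqShift : Module.End ℤ (ℕ → G) :=
  LinearMap.funLeft ℤ G Nat.succ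

variable {G}

theorem aeval_seqShift_X_pow_apply (m : ℕ) (f : ℕ → G) (i : ℕ) :
    aeval (seqShift G) (X ^ m : ℤ[X]) f i = f (i + m) := by
  induction m generalizing i with
  | zero => simp
  | succ m ih =>
    rw [pow_succ', map_mul, Module.End.mul_apply, aeval_X, seqShift, LinearMap.funLeft_apply,
      ← seqShift, ih, Nat.succ_add_eq_add_succ]

theorem aeval_seqShift_X_pow_sub_one (N : ℕ) (f : ℕ → G) :
    aeval (seqShift G) (X ^ N - 1 : ℤ[X]) f = fwdDiff N f := by
  ext i
  rw [map_sub, LinearMap.sub_apply, Pi.sub_apply, aeval_seqShift_X_pow_apply, map_one,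
    Module.End.one_apply, fwdDiff]

theorem aeval_seqShift_X_pow_sub_one_pow (N k : ℕ) (f : ℕ → G) :
    aeval (seqShift G) ((X ^ N - 1) ^ k : ℤ[X]) f = (fwdDiff N)^[k] f := by
  induction k with
  | zero => simp
  | succ k ih =>
    rw [pow_succ', map_mul, Module.End.mul_apply, ih, aeval_seqShift_X_pow_sub_one,
      Function.iterate_succ_apply']

theorem aeval_apply_eq_zero_of_dvd {R M : Type*} [CommSemiring R] [AddCommMonoid M] [Module R M]
    {φ : Module.End R M} {p q : R[X]} (hpq : p ∣ q) {x : M} (hp : aeval φ p x = 0) :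
    aeval φ q x = 0 := by
  obtain ⟨r, rfl⟩ := hpq
  rw [mul_comm, map_mul, Module.End.mul_apply, hp, map_zero]

end SequenceShift

/-- A sequence annihilated, as an element of the module of sequences over the polynomial ring that
acts by shifts, by some `X ^ m * (X ^ N - 1) ^ k` with `N` positive. The roots of this polynomial
are `0` and roots of unity, so these are the sequences that eventually agree with a quasi-polynomial
of period `N`; the definition makes the closure properties formal and needs no division in `G`. -/
def IsShiftQuasiPolynomial {G : Type*} [AddCommGroup G] (f : ℕ → G) : Prop :=
  ∃ m N k : ℕ, 0 < N ∧ aeval (seqShift G) (X ^ m * (X ^ N - 1) ^ k : ℤ[X]) f = 0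

theorem X_pow_mul_X_pow_sub_one_pow_dvd {R : Type*} [CommRing R] {m m' N N' k k' : ℕ}
    (hm : m ≤ m') (hN : N ∣ N') (hk : k ≤ k') :
    (X ^ m * (X ^ N - 1) ^ k : R[X]) ∣ X ^ m' * (X ^ N' - 1) ^ k' := by
  obtain ⟨d, rfl⟩ := hN
  refine mul_dvd_mul (pow_dvd_pow _ hm) ((pow_dvd_pow _ hk).trans (pow_dvd_pow_of_dvd ?_ _))
  simpa only [pow_mul, one_pow] using sub_dvd_pow_sub_pow (X ^ N : R[X]) 1 d

namespace IsShiftQuasiPolynomial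

variable {G : Type*} [AddCommGroup G] {f g : ℕ → G}

theorem zero : IsShiftQuasiPolynomial (0 : ℕ → G) :=
  ⟨0, 1, 0, one_pos, map_zero _⟩

theorem add (hf : IsShiftQuasiPolynomial f) (hg : IsShiftQuasiPolynomial g) :
    IsShiftQuasiPolynomial (f + g) := by
  obtain ⟨m, N, k, hN, hf⟩ := hf
  obtain ⟨m', N', k', hN', hg⟩ := hg
  refine ⟨m + m', N * N', k + k', Nat.mul_pos hN hN', ?_⟩
  rw [map_add,
    aeval_apply_eq_zero_of_dvd (X_pow_mul_X_pow_sub_one_pow_dvd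
      (m.le_add_right m') (N.dvd_mul_right N') (k.le_add_right k')) hf,
    aeval_apply_eq_zero_of_dvd (X_pow_mul_X_pow_sub_one_pow_dvd
      (m'.le_add_left m) (N'.dvd_mul_left N) (k'.le_add_left k)) hg, add_zero]

theorem neg (hf : IsShiftQuasiPolynomial f) : IsShiftQuasiPolynomial (-f) := by
  obtain ⟨m, N, k, hN, hf⟩ := hf
  exact ⟨m, N, k, hN, by rw [map_neg, hf, neg_zero]⟩

theorem sub (hf : IsShiftQuasiPolynomial f) (hg : IsShiftQuasiPolynomial g) :
    IsShiftQuasiPolynomial (f - g) :=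
  sub_eq_add_neg f g ▸ hf.add hg.neg

theorem of_shift (d : ℕ) (h : IsShiftQuasiPolynomial fun i => f (i + d)) :
    IsShiftQuasiPolynomial f := by
  obtain ⟨m, N, k, hN, h⟩ := h
  refine ⟨m + d, N, k, hN, ?_⟩
  rw [pow_add, mul_right_comm, map_mul, Module.End.mul_apply, ← h]
  exact congrArg _ (funext (aeval_seqShift_X_pow_apply d f))

theorem shift (d : ℕ) (h : IsShiftQuasiPolynomial f) :
    IsShiftQuasiPolynomial fun i => f (i + d) := by
  obtain ⟨m, N, k, hN, h⟩ := h
  refine ⟨m, N, k, hN, ?_⟩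
  rw [← funext (aeval_seqShift_X_pow_apply d f), ← Module.End.mul_apply, ← map_mul, mul_comm,
    map_mul, Module.End.mul_apply, h, map_zero]

theorem of_fwdDiff {d : ℕ} (hd : 0 < d) (h : IsShiftQuasiPolynomial (fwdDiff d f)) :
    IsShiftQuasiPolynomial f := by
  obtain ⟨m, N, k, hN, h⟩ := h
  refine ⟨m, N * d, k + 1, Nat.mul_pos hN hd, ?_⟩
  rw [← aeval_seqShift_X_pow_sub_one, ← Module.End.mul_apply, ← map_mul] at h
  refine aeval_apply_eq_zero_of_dvd ?_ h
  rw [pow_succ, ← mul_assoc]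
  refine mul_dvd_mul (X_pow_mul_X_pow_sub_one_pow_dvd le_rfl (N.dvd_mul_right d) le_rfl) ?_
  simpa only [pow_zero, one_mul, pow_one] using
    X_pow_mul_X_pow_sub_one_pow_dvd (R := ℤ) (m := 0) (k := 1) le_rfl (d.dvd_mul_left N) le_rfl

theorem exists_fwdDiff_iterate_eq_zero (hf : IsShiftQuasiPolynomial f) :
    ∃ m N k : ℕ, 0 < N ∧ ∀ y, m ≤ y → ∀ j, k ≤ j → (fwdDiff N)^[j] f y = 0 := by
  obtain ⟨m, N, k, hN, hf⟩ := hf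
  refine ⟨m, N, k, hN, fun y hy j hj => ?_⟩
  have h := congrFun (aeval_apply_eq_zero_of_dvd
    (X_pow_mul_X_pow_sub_one_pow_dvd le_rfl (dvd_refl N) hj) hf) (y - m)
  rwa [map_mul, Module.End.mul_apply, aeval_seqShift_X_pow_apply, aeval_seqShift_X_pow_sub_one_pow,
    Nat.sub_add_cancel hy] at h

end IsShiftQuasiPolynomial

theorem exists_polynomial_eval_eq_of_fwdDiff_iterate_eq_zero {M K : Type*} [AddCommMonoid M]
    [Field K] [CharZero K] {f : M → K} {h y : M} {k : ℕ}
    (hk : ∀ j, k ≤ j → (fwdDiff h)^[j] f y = 0) :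
    ∃ P : K[X], ∀ n : ℕ, f (y + n • h) = P.eval (n : K) := by
  refine ⟨∑ j ∈ Finset.range k,
    C ((fwdDiff h)^[j] f y / j.factorial) * descPochhammer K j, fun n => ?_⟩
  have eval_term (j : ℕ) : (C ((fwdDiff h)^[j] f y / j.factorial) * descPochhammer K j).eval
      (n : K) = n.choose j • (fwdDiff h)^[j] f y := by
    rw [eval_mul, eval_C, nsmul_eq_mul, Nat.cast_choose_eq_descPochhammer_div, div_mul_eq_mul_div,
      mul_comm, mul_div_right_comm]
  simp_rw [eval_finsetSum, eval_term]
  rw [shift_eq_sum_fwdDiff_iter h f n y]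
  trans ∑ j ∈ Finset.range (n + 1 + k), n.choose j • (fwdDiff h)^[j] f y
  · refine Finset.sum_subset (Finset.range_mono (Nat.le_add_right _ _)) fun j _ hj => ?_
    rw [Nat.choose_eq_zero_of_lt (by simpa using hj), zero_smul]
  · refine (Finset.sum_subset (Finset.range_mono (Nat.le_add_left _ _)) fun j _ hj => ?_).symm
    rw [hk j (by simpa using hj), smul_zero]

theorem isQuasiPolynomial_eval_emod {N : ℕ} (hN : 0 < N) (Q : ℤ → ℂ[X]) :
    IsQuasiPolynomial fun n => (Q (n % N)).eval (n : ℂ) := by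
  refine ⟨N, hN, fun r => Q (r : ℕ), fun n r hr => ?_⟩
  have hmod : n % N = (r : ℕ) := by
    rw [hr, Int.emod_eq_of_lt (by omega) (by exact_mod_cast r.2)]
  simp only [hmod]

theorem isQuasiPolynomialType_of_exists_polynomial {g : ℕ → ℂ} {m N : ℕ} (hN : 0 < N)
    (hg : ∀ y, m ≤ y → ∃ P : ℂ[X], ∀ l : ℕ, g (y + l * N) = P.eval (l : ℂ)) :
    IsQuasiPolynomialType g := by
  have start_le (r : ℕ) : m ≤ r + m * N :=
    (Nat.le_mul_of_pos_right m hN).trans (Nat.le_add_left _ _)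
  choose P hP using fun r => hg (r + m * N) (start_le r)
  let Q (r : ℤ) : ℂ[X] := (P r.toNat).comp
    (C (N : ℂ)⁻¹ * (X - C ((r.toNat + m * N : ℕ) : ℂ)))
  refine ⟨m * N + N, _, isQuasiPolynomial_eval_emod hN Q, fun n hn => ?_⟩
  have hmod : ((n : ℤ) % N).toNat = n % N := by norm_cast
  obtain ⟨l, hl⟩ : ∃ l, n = n % N + m * N + l * N := by
    have hm : m ≤ n / N := by
      rw [Nat.le_div_iff_mul_le hN]
      omega
    refine ⟨n / N - m, ?_⟩
    rw [add_assoc, ← Nat.add_mul, Nat.add_sub_cancel' hm, mul_comm, Nat.mod_add_div]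
  have harg : (C (N : ℂ)⁻¹ * (X - C ((n % N + m * N : ℕ) : ℂ)) : ℂ[X]).eval (n : ℂ) = l := by
    have hN' : (N : ℂ) ≠ 0 := Nat.cast_ne_zero.mpr hN.ne'
    have hn' : (n : ℂ) = ((n % N + m * N : ℕ) : ℂ) + l * N := by exact_mod_cast hl
    rw [eval_mul, eval_sub, eval_C, eval_X, eval_C, sub_eq_of_eq_add' hn', mul_comm,
      mul_inv_cancel_right₀ hN']
  rw [eval_comp, hmod, Int.cast_natCast, harg, ← hP, ← hl]

theorem IsShiftQuasiPolynomial.isQuasiPolynomialType {f : ℕ → ℂ} (hf : IsShiftQuasiPolynomial f) :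
    IsQuasiPolynomialType f := by
  obtain ⟨m, N, k, hN, hΔ⟩ := hf.exists_fwdDiff_iterate_eq_zero
  exact isQuasiPolynomialType_of_exists_polynomial hN fun y hy =>
    exists_polynomial_eval_eq_of_fwdDiff_iterate_eq_zero (h := N) (hΔ y hy)

section ImageFiber

variable {α β : Type*} {deg : α → ℕ} {deg' : β → ℕ} {A : Set α} {f : α → β} {e i : ℕ}

theorem image_inter_preimage_singleton_add (hdeg : ∀ x ∈ A, deg' (f x) = deg x + e) :
    f '' A ∩ deg' ⁻¹' {i + e} = f '' (A ∩ deg ⁻¹' {i}) := by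
  rw [← Set.image_inter_preimage]
  congr 1
  ext x
  exact and_congr_right fun hx => by simp [hdeg x hx]

theorem image_inter_preimage_singleton_of_lt (hdeg : ∀ x ∈ A, deg' (f x) = deg x + e)
    (hi : i < e) : f '' A ∩ deg' ⁻¹' {i} = ∅ := by
  rw [← Set.image_inter_preimage, Set.image_eq_empty]
  refine Set.eq_empty_of_forall_notMem fun x ⟨hx, hxi⟩ => ?_
  rw [Set.mem_preimage, Set.mem_preimage, hdeg x hx, Set.mem_singleton_iff] at hxi
  omega

end ImageFiber

/-- The subset `A` has finitely many elements of each degree, and their number is a shift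
quasi-polynomial function of the degree. -/
structure HasQuasiPolynomialCount {α : Type*} (deg : α → ℕ) (A : Set α) : Prop where
  finite_fiber : ∀ i, (A ∩ deg ⁻¹' {i}).Finite
  isShiftQuasiPolynomial : IsShiftQuasiPolynomial fun i => ((A ∩ deg ⁻¹' {i}).ncard : ℂ)

namespace HasQuasiPolynomialCount

variable {α β ι : Type*} {deg : α → ℕ} {A B : Set α}

theorem empty : HasQuasiPolynomialCount deg (∅ : Set α) :=
  ⟨fun i => by simp, by simpa using! IsShiftQuasiPolynomial.zero⟩

theorem singleton (a : α) : HasQuasiPolynomialCount deg {a} := by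
  refine ⟨fun i => (Set.finite_singleton a).inter_of_left _, .of_shift (deg a + 1) ?_⟩
  convert! IsShiftQuasiPolynomial.zero using 1
  ext i
  have hfiber : {a} ∩ deg ⁻¹' {i + (deg a + 1)} = ∅ :=
    Set.singleton_inter_eq_empty.2 fun h : deg a = i + (deg a + 1) => by omega
  rw [hfiber, Set.ncard_empty, Nat.cast_zero, Pi.zero_apply]

theorem union (hA : HasQuasiPolynomialCount deg A) (hB : HasQuasiPolynomialCount deg B)
    (hAB : HasQuasiPolynomialCount deg (A ∩ B)) : HasQuasiPolynomialCount deg (A ∪ B) := by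
  refine ⟨fun i => Set.union_inter_distrib_right A B _ ▸
    (hA.finite_fiber i).union (hB.finite_fiber i), ?_⟩
  convert! (hA.isShiftQuasiPolynomial.add hB.isShiftQuasiPolynomial).sub
    hAB.isShiftQuasiPolynomial using 1
  ext i
  have h := Set.ncard_union_add_ncard_inter _ _ (hA.finite_fiber i) (hB.finite_fiber i)
  rw [← Set.union_inter_distrib_right, ← Set.inter_inter_distrib_right] at h
  rw [Pi.sub_apply, Pi.add_apply, eq_sub_iff_add_eq]
  exact_mod_cast h

theorem union_of_disjoint (hA : HasQuasiPolynomialCount deg A)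
    (hB : HasQuasiPolynomialCount deg B) (h : Disjoint A B) :
    HasQuasiPolynomialCount deg (A ∪ B) :=
  hA.union hB (h.inter_eq ▸ empty)

theorem sdiff (hA : HasQuasiPolynomialCount deg A) (hB : HasQuasiPolynomialCount deg B)
    (h : B ⊆ A) : HasQuasiPolynomialCount deg (A \ B) := by
  refine ⟨fun i => (hA.finite_fiber i).subset (Set.inter_subset_inter_left _ Set.sdiff_subset), ?_⟩
  convert! hA.isShiftQuasiPolynomial.sub hB.isShiftQuasiPolynomial using 1
  ext i
  have hcard := Set.ncard_sdiff_add_ncard_of_subset (Set.inter_subset_inter_left (deg ⁻¹' {i}) h)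
    (hA.finite_fiber i)
  rw [← Set.inter_sdiff_distrib_right] at hcard
  rw [Pi.sub_apply, eq_sub_iff_add_eq]
  exact_mod_cast hcard

theorem image (hA : HasQuasiPolynomialCount deg A) {deg' : β → ℕ} {f : α → β} (e : ℕ)
    (hf : Set.InjOn f A) (hdeg : ∀ x ∈ A, deg' (f x) = deg x + e) :
    HasQuasiPolynomialCount deg' (f '' A) := by
  constructor
  · intro i
    rcases lt_or_ge i e with hi | hi
    · rw [image_inter_preimage_singleton_of_lt hdeg hi]
      exact Set.finite_empty
    · rw [← Nat.sub_add_cancel hi, image_inter_preimage_singleton_add hdeg]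
      exact (hA.finite_fiber _).image f
  · refine .of_shift e ?_
    convert! hA.isShiftQuasiPolynomial using 3 with i
    rw [image_inter_preimage_singleton_add hdeg, (hf.mono Set.inter_subset_left).ncard_image]

theorem of_eq_union_image {f : α → α} {d : ℕ} (hd : 0 < d) (hf : Set.InjOn f A)
    (hdeg : ∀ x ∈ A, deg (f x) = deg x + d) (hA : A = B ∪ f '' A) (hdisj : Disjoint B (f '' A))
    (hB : HasQuasiPolynomialCount deg B) : HasQuasiPolynomialCount deg A := by
  have fiber_add (i : ℕ) :
      A ∩ deg ⁻¹' {i + d} = B ∩ deg ⁻¹' {i + d} ∪ f '' (A ∩ deg ⁻¹' {i}) := by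
    conv_lhs => rw [hA, Set.union_inter_distrib_right, image_inter_preimage_singleton_add hdeg]
  have finite_fiber (i : ℕ) : (A ∩ deg ⁻¹' {i}).Finite := by
    induction i using Nat.strong_induction_on with
    | h i ih =>
      rcases lt_or_ge i d with hi | hi
      · rw [hA, Set.union_inter_distrib_right, image_inter_preimage_singleton_of_lt hdeg hi,
          Set.union_empty]
        exact hB.finite_fiber i
      · rw [← Nat.sub_add_cancel hi, fiber_add]
        exact (hB.finite_fiber _).union ((ih (i - d) (by omega)).image f)
  refine ⟨finite_fiber, .of_fwdDiff hd ?_⟩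
  convert! hB.isShiftQuasiPolynomial.shift d using 1
  ext i
  have hdisj_fiber : Disjoint (B ∩ deg ⁻¹' {i + d}) (f '' (A ∩ deg ⁻¹' {i})) :=
    hdisj.mono Set.inter_subset_left (Set.image_mono Set.inter_subset_left)
  rw [fwdDiff, fiber_add, Set.ncard_union_eq hdisj_fiber (hB.finite_fiber _)
    ((finite_fiber i).image f), (hf.mono Set.inter_subset_left).ncard_image, Nat.cast_add,
    add_sub_cancel_right]

-- Inclusion-exclusion, without signs: the recursion stays inside the family `C`.
theorem biUnion_of_infClosed {C : Set (Set α)} (hC : InfClosed C)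
    (hcount : ∀ A ∈ C, HasQuasiPolynomialCount deg A) {s : Set ι} (hs : s.Finite)
    {A : ι → Set α} (hA : ∀ i ∈ s, A i ∈ C) : HasQuasiPolynomialCount deg (⋃ i ∈ s, A i) := by
  induction s, hs using Set.Finite.induction_on generalizing A with
  | empty => simpa using empty
  | @insert a s _ _ ih =>
    have ha : A a ∈ C := hA a (Set.mem_insert a s)
    have hs (i : ι) (hi : i ∈ s) : A i ∈ C := hA i (Set.mem_insert_of_mem a hi)
    rw [Set.biUnion_insert]
    refine (hcount _ ha).union (ih hs) ?_
    rw [Set.inter_iUnion₂]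
    exact ih fun i hi => hC ha (hs i hi)

theorem of_fibers [Finite ι] (π : α → ι)
    (hA : ∀ i, HasQuasiPolynomialCount deg (A ∩ π ⁻¹' {i})) : HasQuasiPolynomialCount deg A := by
  have hunion : A = ⋃ i ∈ Set.univ, A ∩ π ⁻¹' {i} := by
    ext x
    simp
  rw [hunion]
  refine biUnion_of_infClosed (C := insert ∅ (Set.range fun i => A ∩ π ⁻¹' {i})) ?_ ?_
    Set.finite_univ fun i _ => .inr ⟨i, rfl⟩
  · rintro _ (rfl | ⟨i, rfl⟩) _ (rfl | ⟨j, rfl⟩)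
    · simp
    · simp
    · simp
    · by_cases hij : i = j
      · exact .inr ⟨i, by simp [hij]⟩
      · refine .inl (Set.eq_empty_of_forall_notMem fun x hx => hij ?_)
        exact hx.1.2.symm.trans hx.2.2
  · rintro _ (rfl | ⟨i, rfl⟩)
    · exact empty
    · exact hA i

end HasQuasiPolynomialCount

section FreeCommMonoid

variable {ι : Type*} [DecidableEq ι]

theorem setOf_support_subset_insert (a : ι) (s : Set ι) :
    {c : ι → ℕ | Function.support c ⊆ insert a s} = {c : ι → ℕ | Function.support c ⊆ s} ∪
      (· + Pi.single a 1) '' {c : ι → ℕ | Function.support c ⊆ insert a s} := by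
  ext c
  constructor
  · intro hc
    by_cases hca : c a = 0
    · exact .inl fun k hk => (hc hk).resolve_left fun hka => hk (hka ▸ hca)
    · have hle : Pi.single a 1 ≤ c :=
        update_le_iff.2 ⟨Nat.one_le_iff_ne_zero.2 hca, fun _ _ => Nat.zero_le _⟩
      exact .inr ⟨c - Pi.single a 1, fun k hk => hc fun h0 => hk (by simp [h0]),
        tsub_add_cancel_of_le hle⟩
  · rintro (hc | ⟨c, hc, rfl⟩)
    · exact fun k hk => .inr (hc hk)
    · refine (Function.support_add c _).trans (Set.union_subset hc ?_)
      exact (Pi.support_single_subset).trans (by simp)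

variable {δ : (ι → ℕ) →+ ℕ}

theorem hasQuasiPolynomialCount_setOf_support_subset (hδ : ∀ k, 0 < δ (Pi.single k 1))
    {s : Set ι} (hs : s.Finite) : HasQuasiPolynomialCount δ {c | Function.support c ⊆ s} := by
  induction s, hs using Set.Finite.induction_on with
  | empty => simpa [Set.subset_empty_iff] using HasQuasiPolynomialCount.singleton (0 : ι → ℕ)
  | @insert a s ha _ ih =>
    refine .of_eq_union_image (hδ a) (add_left_injective _).injOn
      (fun c _ => map_add δ c _) (setOf_support_subset_insert a s) ?_ ih
    rw [Set.disjoint_left]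
    rintro _ hc ⟨c, -, rfl⟩
    exact ha (hc (by simp))

theorem hasQuasiPolynomialCount_univ [Finite ι] (hδ : ∀ k, 0 < δ (Pi.single k 1)) :
    HasQuasiPolynomialCount δ Set.univ := by
  simpa using hasQuasiPolynomialCount_setOf_support_subset hδ Set.finite_univ

theorem hasQuasiPolynomialCount_Ici [Finite ι] (hδ : ∀ k, 0 < δ (Pi.single k 1)) (v : ι → ℕ) :
    HasQuasiPolynomialCount δ (Set.Ici v) := by
  have hIci : Set.Ici v = (· + v) '' Set.univ := by
    rw [Set.image_univ]
    exact Set.ext fun c => ⟨fun h => ⟨c - v, tsub_add_cancel_of_le h⟩,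
      fun ⟨c', h⟩ => h ▸ (le_add_self : v ≤ c' + v)⟩
  rw [hIci]
  exact (hasQuasiPolynomialCount_univ hδ).image (δ v) (add_left_injective v).injOn
    fun c _ => map_add δ c v

end FreeCommMonoid

theorem exists_finite_subset_biUnion_Ici {α : Type*} [PartialOrder α] [WellQuasiOrderedLE α]
    (S : Set α) : ∃ T ⊆ S, T.Finite ∧ S ⊆ ⋃ v ∈ T, Set.Ici v := by
  refine ⟨{x | Minimal (· ∈ S) x}, setOfPred_minimal_subset _,
    WellQuasiOrderedLE.finite_of_isAntichain (setOfPred_minimal_antichain _), fun x hx => ?_⟩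
  obtain ⟨y, hy, hmin⟩ := (Set.isPWO_of_wellQuasiOrderedLE S).exists_le_minimal hx
  exact Set.mem_biUnion hmin hy

theorem hasQuasiPolynomialCount_of_isUpperSet {ι : Type*} [Finite ι] [DecidableEq ι]
    {δ : (ι → ℕ) →+ ℕ} (hδ : ∀ k, 0 < δ (Pi.single k 1)) {S : Set (ι → ℕ)} (hS : IsUpperSet S) :
    HasQuasiPolynomialCount δ S := by
  obtain ⟨T, hTS, hT, hST⟩ := exists_finite_subset_biUnion_Ici S
  rw [hST.antisymm (Set.iUnion₂_subset fun v hv c hvc => hS hvc (hTS hv))]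
  refine .biUnion_of_infClosed (C := Set.range Set.Ici) ?_ ?_ hT fun v _ => ⟨v, rfl⟩
  · rintro _ ⟨v, rfl⟩ _ ⟨w, rfl⟩
    exact ⟨v ⊔ w, Set.Ici_inter_Ici.symm⟩
  · rintro _ ⟨v, rfl⟩
    exact hasQuasiPolynomialCount_Ici hδ v

section LexMinCoords

variable {ι M : Type*} [LinearOrder ι] [Finite ι] [AddCommMonoid M]

/-- The coordinate vectors that are lexicographically smallest among those with the same value under
`g`: a normal form for the elements of the range of `g`. -/
def lexMinCoords (g : (ι → ℕ) →+ M) : Set (ι → ℕ) :=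
  {c | ∀ c', g c' = g c → toLex c ≤ toLex c'}

theorem isLowerSet_lexMinCoords (g : (ι → ℕ) →+ M) : IsLowerSet (lexMinCoords g) := by
  intro c c₀ hle hc c' hc'
  obtain ⟨w, rfl⟩ := exists_add_of_le hle
  have h := hc (c' + w) (by rw [map_add, map_add, hc'])
  rwa [toLex_add, toLex_add, add_le_add_iff_right] at h

theorem bijOn_lexMinCoords (g : (ι → ℕ) →+ M) : Set.BijOn g (lexMinCoords g) (Set.range g) := by
  refine ⟨fun c _ => ⟨c, rfl⟩, fun c hc c' hc' h => ?_, ?_⟩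
  · exact toLex.injective ((hc c' h.symm).antisymm (hc' c h))
  · rintro _ ⟨c, rfl⟩
    obtain ⟨c₀, hc₀, hmin⟩ := WellFounded.has_min
      (InvImage.wf (toLex : (ι → ℕ) → Lex (ι → ℕ)) wellFounded_lt) {c' | g c' = g c} ⟨c, rfl⟩
    rw [Set.mem_ofPred_eq] at hc₀
    exact ⟨c₀, fun c' hc' => not_lt.1 (hmin c' (hc'.trans hc₀)), hc₀⟩

-- Passing to normal forms turns the set into the complement of an upper set of coordinate vectors.
theorem hasQuasiPolynomialCount_vadd_range_sdiff [IsCancelAdd M] {δ : M →+ ℕ} {g : (ι → ℕ) →+ M}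
    (hg : ∀ k, 0 < δ (g (Pi.single k 1))) (b : M) {X : Set M} (hX : X + Set.range g ⊆ X) :
    HasQuasiPolynomialCount δ ((b +ᵥ Set.range g) \ X) := by
  have hX_upper : IsUpperSet {c | b + g c ∈ X} := by
    intro c₁ c₂ hle hc
    obtain ⟨w, rfl⟩ := exists_add_of_le hle
    rw [Set.mem_ofPred_eq, map_add, ← add_assoc]
    exact hX (Set.add_mem_add hc ⟨w, rfl⟩)
  have hcount := (hasQuasiPolynomialCount_univ (δ := δ.comp g) hg).sdiff
    (hasQuasiPolynomialCount_of_isUpperSet hg ((isLowerSet_lexMinCoords g).compl.union hX_upper))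
    (Set.subset_univ _)
  rw [← Set.compl_eq_univ_sdiff, Set.compl_union, compl_compl] at hcount
  have himage : (b +ᵥ Set.range g) \ X =
      (fun c => b + g c) '' (lexMinCoords g ∩ {c | b + g c ∈ X}ᶜ) := by
    rw [← (bijOn_lexMinCoords g).image_eq, ← Set.image_vadd, Set.image_image, Set.sdiff_eq,
      ← Set.image_inter_preimage]
    rfl
  rw [himage]
  refine hcount.image (δ b) ?_ fun c _ => ?_
  · exact fun c hc c' hc' h => (bijOn_lexMinCoords g).injOn hc.1 hc'.1 (add_left_cancel h)
  · rw [map_add, add_comm, AddMonoidHom.comp_apply]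

end LexMinCoords

section HybridLinearSet

variable {M : Type*} [AddCommMonoid M]

theorem exists_fin_addMonoidHom_mrange_eq_of_pos {δ : M →+ ℕ} {N : AddSubmonoid M} (hN : N.FG)
    (hpos : ∀ m ∈ N, δ m = 0 → m = 0) :
    ∃ (n : ℕ) (g : (Fin n → ℕ) →+ M), AddMonoidHom.mrange g = N ∧
      ∀ k, 0 < δ (g (Pi.single k 1)) := by
  classical
  obtain ⟨t, rfl⟩ := hN
  let gen (k : Fin (t.erase 0).card) : M := (t.erase 0).equivFin.symm k
  have range_gen : Set.range gen = (t : Set M) \ {0} := by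
    rw [← Finset.coe_erase, ← Subtype.range_coe (s := (t.erase 0 : Set M))]
    exact (t.erase 0).equivFin.symm.surjective.range_comp Subtype.val
  refine ⟨_, (Fintype.linearCombination ℕ gen).toAddMonoidHom, ?_, fun k => ?_⟩
  · ext x
    rw [← AddSubmonoid.closure_sdiff_singleton_zero, ← range_gen,
      AddSubmonoid.mem_closure_range_iff_of_fintype, AddMonoidHom.mem_mrange]
    exact exists_congr fun c => eq_comm
  · obtain ⟨hk, hk0⟩ : gen k ∈ (t : Set M) \ {0} := range_gen ▸ Set.mem_range_self k
    rw [LinearMap.toAddMonoidHom_coe, Fintype.linearCombination_apply_single, one_smul]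
    exact Nat.pos_of_ne_zero fun h => hk0 (hpos _ (AddSubmonoid.subset_closure hk) h)

section EqLocus

variable {P P₁ P₂ : Type*} [AddCommMonoid P] [AddCommMonoid P₁] [AddCommMonoid P₂]

theorem vadd_range_inter_vadd_range (g₁ : P₁ →+ M) (g₂ : P₂ →+ M) (b₁ b₂ : M) :
    (b₁ +ᵥ Set.range g₁) ∩ (b₂ +ᵥ Set.range g₂) = b₁ +ᵥ g₁.comp (.fst P₁ P₂) ''
      {z | b₁ + g₁.comp (.fst P₁ P₂) z = b₂ + g₂.comp (.snd P₁ P₂) z} := by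
  ext x
  constructor
  · rintro ⟨⟨_, ⟨c, rfl⟩, rfl⟩, _, ⟨d, rfl⟩, hd⟩
    exact ⟨_, ⟨(c, d), hd.symm, rfl⟩, rfl⟩
  · rintro ⟨_, ⟨z, hz, rfl⟩, rfl⟩
    exact ⟨⟨_, ⟨z.1, rfl⟩, rfl⟩, _, ⟨z.2, rfl⟩, hz.symm⟩

theorem mrange_inf_mrange (g₁ : P₁ →+ M) (g₂ : P₂ →+ M) :
    AddMonoidHom.mrange g₁ ⊓ AddMonoidHom.mrange g₂ =
      ((g₁.comp (.fst P₁ P₂)).eqLocusM (g₂.comp (.snd P₁ P₂))).map (g₁.comp (.fst P₁ P₂)) := by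
  apply SetLike.coe_injective
  simpa only [zero_vadd, zero_add] using! vadd_range_inter_vadd_range g₁ g₂ 0 0

theorem exists_finite_setOf_eq_add_eqLocusM [PartialOrder P] [CanonicallyOrderedAdd P]
    [WellQuasiOrderedLE P] [IsLeftCancelAdd M] (f g : P →+ M) (a b : M) :
    ∃ T : Set P, T.Finite ∧ {z | a + f z = b + g z} = T + (f.eqLocusM g : Set P) := by
  obtain ⟨T, hT, hTfin, hmin⟩ := exists_finite_subset_biUnion_Ici {z | a + f z = b + g z}
  refine ⟨T, hTfin, Set.Subset.antisymm (fun z hz => ?_) ?_⟩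
  · obtain ⟨v, hv, hvz⟩ := Set.mem_iUnion₂.1 (hmin hz)
    obtain ⟨w, rfl⟩ := exists_add_of_le hvz
    refine Set.add_mem_add hv (?_ : f w = g w)
    rw [Set.mem_ofPred_eq, map_add, map_add, ← add_assoc, ← add_assoc, hT hv] at hz
    exact add_left_cancel hz
  · rintro _ ⟨v, hv, w, hw, rfl⟩
    have hvab : a + f v = b + g v := hT hv
    have hfgw : f w = g w := hw
    rw [Set.mem_ofPred_eq, map_add, map_add, ← add_assoc, hvab, hfgw, add_assoc]

end EqLocus

variable [IsCancelAdd M]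

theorem fg_inf_of_isCancelAdd {N₁ N₂ : AddSubmonoid M} (h₁ : N₁.FG) (h₂ : N₂.FG) :
    (N₁ ⊓ N₂).FG := by
  obtain ⟨n₁, g₁, rfl⟩ := AddSubmonoid.fg_iff_exists_fin_addMonoidHom.1 h₁
  obtain ⟨n₂, g₂, rfl⟩ := AddSubmonoid.fg_iff_exists_fin_addMonoidHom.1 h₂
  rw [mrange_inf_mrange]
  exact (AddSubmonoid.fg_eqLocusM _ _).map _

theorem exists_finite_vadd_inter_vadd_eq {N₁ N₂ : AddSubmonoid M} (h₁ : N₁.FG) (h₂ : N₂.FG)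
    (b₁ b₂ : M) : ∃ F : Set M, F.Finite ∧
      (b₁ +ᵥ (N₁ : Set M)) ∩ (b₂ +ᵥ (N₂ : Set M)) = F + ((N₁ ⊓ N₂ : AddSubmonoid M) : Set M) := by
  obtain ⟨n₁, g₁, rfl⟩ := AddSubmonoid.fg_iff_exists_fin_addMonoidHom.1 h₁
  obtain ⟨n₂, g₂, rfl⟩ := AddSubmonoid.fg_iff_exists_fin_addMonoidHom.1 h₂
  obtain ⟨T, hT, hT_eq⟩ := exists_finite_setOf_eq_add_eqLocusM
    (g₁.comp (AddMonoidHom.fst (Fin n₁ → ℕ) (Fin n₂ → ℕ)))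
    (g₂.comp (AddMonoidHom.snd (Fin n₁ → ℕ) (Fin n₂ → ℕ))) b₁ b₂
  refine ⟨b₁ +ᵥ g₁.comp (.fst _ _) '' T, (hT.image _).vadd_set, ?_⟩
  rw [AddMonoidHom.coe_mrange, AddMonoidHom.coe_mrange, vadd_range_inter_vadd_range, hT_eq,
    Set.image_add, vadd_add_assoc, mrange_inf_mrange, AddSubmonoid.coe_map]

/-- A hybrid linear set: the sum of a finite set of bases and a single finitely generated monoid of
periods; moreover the nonzero periods are required to have positive degree, so that the set has
finitely many elements of each degree. -/
def IsHybridLinearSet (δ : M →+ ℕ) (X : Set M) : Prop :=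
  ∃ (F : Set M) (N : AddSubmonoid M), F.Finite ∧ N.FG ∧ (∀ m ∈ N, δ m = 0 → m = 0) ∧
    X = F + (N : Set M)

namespace IsHybridLinearSet

variable {δ : M →+ ℕ} {X Y : Set M}

theorem inter (hX : IsHybridLinearSet δ X) (hY : IsHybridLinearSet δ Y) :
    IsHybridLinearSet δ (X ∩ Y) := by
  obtain ⟨F₁, N₁, hF₁, hN₁, hpos, rfl⟩ := hX
  obtain ⟨F₂, N₂, hF₂, hN₂, -, rfl⟩ := hY
  choose F hF hF_eq using exists_finite_vadd_inter_vadd_eq hN₁ hN₂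
  refine ⟨⋃ b₁ ∈ F₁, ⋃ b₂ ∈ F₂, F b₁ b₂, N₁ ⊓ N₂,
    hF₁.biUnion fun b₁ _ => hF₂.biUnion fun b₂ _ => hF b₁ b₂, fg_inf_of_isCancelAdd hN₁ hN₂,
    fun m hm => hpos m hm.1, ?_⟩
  simp only [Set.iUnion₂_add, ← hF_eq, ← Set.inter_iUnion₂, ← Set.iUnion₂_inter,
    Set.iUnion_vadd_set, vadd_eq_add]

theorem hasQuasiPolynomialCount (hX : IsHybridLinearSet δ X) : HasQuasiPolynomialCount δ X := by
  obtain ⟨F, N, hF, hN, hpos, rfl⟩ := hX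
  obtain ⟨n, g, rfl, hg⟩ := exists_fin_addMonoidHom_mrange_eq_of_pos hN hpos
  rw [AddMonoidHom.coe_mrange]
  induction F, hF using Set.Finite.induction_on with
  | empty => simpa only [Set.empty_add] using HasQuasiPolynomialCount.empty
  | @insert b F _ _ ih =>
    have hstable : F + Set.range g + Set.range g ⊆ F + Set.range g := by
      rw [add_assoc, ← AddMonoidHom.coe_mrange, AddSubmonoid.coe_add_self_eq]
    rw [Set.insert_eq, Set.union_comm, Set.union_add, Set.singleton_add, ← Set.union_sdiff_self]
    exact ih.union_of_disjoint (hasQuasiPolynomialCount_vadd_range_sdiff hg b hstable)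
      Set.disjoint_sdiff_right

end IsHybridLinearSet

theorem isHybridLinearSet_of_isProperLinearSet {δ : M →+ ℕ} {X : Set M} (hX : IsProperLinearSet X)
    (hfin : ∀ i, (X ∩ δ ⁻¹' {i}).Finite) : IsHybridLinearSet δ X := by
  obtain ⟨a, t, ht, hind, rfl⟩ := hX
  have period_ne_zero (x : M) (hx : x ∈ t) : δ x ≠ 0 := by
    intro h0
    refine Set.infinite_of_injective_forall_mem (f := fun k : ℕ => a + k • x) ?_ ?_ (hfin (δ a))
    · intro k l hkl
      have hkl : k • x = l • x := add_left_cancel hkl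
      exact Finsupp.single_injective ⟨x, hx⟩ (hind.linearIndependent (by simpa using hkl))
    · intro k
      refine ⟨⟨k • x, AddSubmonoid.nsmul_mem _ (AddSubmonoid.subset_closure hx) k, rfl⟩, ?_⟩
      simp [h0]
  refine ⟨{a}, AddSubmonoid.closure t, Set.finite_singleton a,
    (AddSubmonoid.fg_iff _).2 ⟨t, rfl, ht⟩, fun m hm => ?_, Set.singleton_add.symm⟩
  induction hm using AddSubmonoid.closure_induction with
  | mem x hx => exact fun h => absurd h (period_ne_zero x hx)
  | zero => exact fun _ => rfl
  | add x y _ _ ihx ihy =>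
    intro h
    rw [map_add, Nat.add_eq_zero_iff] at h
    rw [ihx h.1, ihy h.2, add_zero]

theorem hasQuasiPolynomialCount_of_isSemilinearSet {δ : M →+ ℕ} {X : Set M}
    (hX : IsSemilinearSet X) (hfin : ∀ i, (X ∩ δ ⁻¹' {i}).Finite) :
    HasQuasiPolynomialCount δ X := by
  obtain ⟨S, hS, rfl⟩ := isProperSemilinearSet_iff.1 hX.isProperSemilinearSet
  rw [Set.sUnion_eq_biUnion]
  refine .biUnion_of_infClosed (C := {X | IsHybridLinearSet δ X}) (fun X hX Y hY => hX.inter hY)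
    (fun X hX => hX.hasQuasiPolynomialCount) S.finite_toSet fun X hXS => ?_
  exact isHybridLinearSet_of_isProperLinearSet (hS X hXS) fun i => (hfin i).subset
    (Set.inter_subset_inter_left _ (Set.subset_sUnion_of_mem hXS))

end HybridLinearSet

section Reachable

variable {Q M : Type*} [AddCommMonoid M]

/-- The least solution of the linear system `X q = I q ∪ ⋃ p, X p + A p q`: the totals collected
along the paths that end in the state `q`, when `I` gives the initial values in the states and `A`
the labels of the transitions. -/
inductive IsReachable (I : Q → Set M) (A : Q → Q → Set M) : Q → M → Prop
  | init {q : Q} {m : M} (hm : m ∈ I q) : IsReachable I A q m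
  | step {p q : Q} {m a : M} (hm : IsReachable I A p m) (ha : a ∈ A p q) :
      IsReachable I A q (m + a)

/-- The row of labels obtained from the row `Y` by adding the detours that go to the state `s`, run
through any number of loops there, and leave it again. -/
def bypass (A : Q → Q → Set M) (s : Q) (Y : Q → Set M) (q : Q) : Set M :=
  Y q ∪ (Y s + (AddSubmonoid.closure (A s s) : Set M) + A s q)

/-- The transition labels after the elimination of the state `s`, which becomes a dead end. -/
def eliminate (A : Q → Q → Set M) (s p q : Q) : Set M :=
  {a | p ≠ s ∧ a ∈ bypass A s (A p) q}

variable {I : Q → Set M} {A : Q → Q → Set M} {Y : Q → Set M} {s q : Q} {m a : M}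

theorem bypass_self_subset :
    bypass A s Y s ⊆ Y s + (AddSubmonoid.closure (A s s) : Set M) := by
  rintro m (hm | ⟨_, ⟨x, hx, y, hy, rfl⟩, a, ha, rfl⟩)
  · exact ⟨m, hm, 0, zero_mem _, add_zero m⟩
  · exact ⟨x, hx, y + a, add_mem hy (AddSubmonoid.subset_closure ha), (add_assoc x y a).symm⟩

theorem add_mem_bypass (hm : m ∈ bypass A s Y s) (ha : a ∈ A s q) : m + a ∈ bypass A s Y q :=
  .inr (Set.add_mem_add (bypass_self_subset hm) ha)

theorem isSemilinearSet_bypass (hA : ∀ p q, IsSemilinearSet (A p q))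
    (hY : ∀ q, IsSemilinearSet (Y q)) (q : Q) : IsSemilinearSet (bypass A s Y q) :=
  (hY q).union (((hY s).add (hA s s).closure).add (hA s q))

theorem isSemilinearSet_eliminate (hA : ∀ p q, IsSemilinearSet (A p q)) (p q : Q) :
    IsSemilinearSet (eliminate A s p q) := by
  by_cases hp : p = s
  · simp [eliminate, hp]
  · simpa [eliminate, hp] using isSemilinearSet_bypass hA (hA p) q

namespace IsReachable

theorem add_of_mem_closure (hm : IsReachable I A q m) (ha : a ∈ AddSubmonoid.closure (A q q)) :
    IsReachable I A q (m + a) := by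
  induction ha using AddSubmonoid.closure_induction generalizing m with
  | mem a ha => exact hm.step ha
  | zero => rwa [add_zero]
  | add a b _ _ iha ihb => exact add_assoc m a b ▸ ihb (iha hm)

theorem add_of_mem_bypass (hY : ∀ q, ∀ y ∈ Y q, IsReachable I A q (m + y))
    (ha : a ∈ bypass A s Y q) : IsReachable I A q (m + a) := by
  rcases ha with ha | ⟨_, ⟨x, hx, y, hy, rfl⟩, z, hz, rfl⟩
  · exact hY q a ha
  · simpa only [add_assoc] using ((hY s x hx).add_of_mem_closure hy).step hz

-- Gaussian elimination: by Arden's rule the loops at `s` can be replaced by their closure.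
theorem iff_eliminate (s : Q) :
    IsReachable I A q m ↔ IsReachable (bypass A s I) (eliminate A s) q m := by
  constructor <;> intro h
  · induction h with
    | init hm => exact .init (.inl hm)
    | @step p q m a _ ha ih =>
      by_cases hp : p = s
      · subst hp
        cases ih with
        | init hm => exact .init (add_mem_bypass hm ha)
        | @step r _ m b hm hb =>
          rw [add_assoc]
          exact hm.step ⟨hb.1, add_mem_bypass hb.2 ha⟩
      · exact ih.step ⟨hp, .inl ha⟩
  · induction h with
    | init hm => simpa using add_of_mem_bypass (m := 0) (fun q y hy => by simpa using! init hy) hm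
    | step _ ha ih => exact add_of_mem_bypass (fun q y hy => ih.step hy) ha.2

theorem isSemilinearSet_of_finite {S : Set Q} (hS : S.Finite) (hI : ∀ q, IsSemilinearSet (I q))
    (hA : ∀ p q, IsSemilinearSet (A p q)) (hAS : ∀ p ∉ S, ∀ q, A p q = ∅) (q : Q) :
    IsSemilinearSet {m | IsReachable I A q m} := by
  induction S, hS using Set.Finite.induction_on generalizing I A with
  | empty =>
    have init_of_isReachable (m : M) (h : IsReachable I A q m) : m ∈ I q := by
      cases h with
      | init hm => exact hm
      | @step p _ _ a _ ha => exact absurd ha (hAS p (Set.notMem_empty p) q ▸ Set.notMem_empty a)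
    exact (Set.Subset.antisymm init_of_isReachable fun m => init) ▸ hI q
  | @insert s S _ _ ih =>
    have setOf_eq : {m | IsReachable I A q m} =
        {m | IsReachable (bypass A s I) (eliminate A s) q m} := Set.ext fun m => iff_eliminate s
    rw [setOf_eq]
    refine ih (isSemilinearSet_bypass hA hI) (isSemilinearSet_eliminate hA) fun p hp r => ?_
    refine Set.eq_empty_of_forall_notMem fun a ⟨hps, ha⟩ => ?_
    have hA_empty := hAS p fun h => h.elim hps hp
    simp [bypass, hA_empty] at ha

end IsReachable

end Reachable

section OrbitCoordinates

variable {V : Type*} (L : Type*) [AddCommGroup L] [AddAction L V]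

/-- The orbit of a vertex. -/
def orbitClass (y : V) : AddAction.orbitRel.Quotient L V :=
  Quotient.mk'' y

theorem exists_vadd_out_eq (y : V) : ∃ u : L, u +ᵥ (orbitClass L y).out = y :=
  AddAction.orbitRel_apply.1
    ((AddAction.orbitRel L V).symm (Quotient.mk_out (s := AddAction.orbitRel L V) y))

/-- A translation, chosen arbitrarily, that takes the representative of the orbit of `y` to `y`. -/
noncomputable def displacement (y : V) : L :=
  (exists_vadd_out_eq L y).choose

theorem displacement_vadd_out (y : V) : displacement L y +ᵥ (orbitClass L y).out = y :=
  (exists_vadd_out_eq L y).choose_spec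

variable {L}

theorem orbitClass_vadd (u : L) (y : V) : orbitClass L (u +ᵥ y) = orbitClass L y :=
  Quotient.sound (AddAction.orbitRel_apply.2 ⟨u, rfl⟩)

theorem orbitClass_out (q : AddAction.orbitRel.Quotient L V) : orbitClass L q.out = q :=
  Quotient.out_eq' q

-- The map `m ↦ (m.1 +ᵥ x, m.2)` factors through an injection of `(L ⧸ stabilizer L x) × ℕ`.
theorem hasQuasiPolynomialCount_image_vadd (x : V) {X : Set (L × ℕ)} (hX : IsSemilinearSet X)
    (hfin : ∀ i, ((fun m : L × ℕ => (m.1 +ᵥ x, m.2)) '' X ∩ Prod.snd ⁻¹' {i}).Finite) :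
    HasQuasiPolynomialCount Prod.snd ((fun m : L × ℕ => (m.1 +ᵥ x, m.2)) '' X) := by
  let φ : L × ℕ →+ (L ⧸ AddAction.stabilizer L x) × ℕ :=
    (QuotientAddGroup.mk' _).prodMap (AddMonoidHom.id ℕ)
  let ψ : (L ⧸ AddAction.stabilizer L x) × ℕ → V × ℕ :=
    Prod.map (AddAction.ofQuotientStabilizer L x) id
  have hψ : ψ.Injective :=
    (AddAction.injective_ofQuotientStabilizer L x).prodMap Function.injective_id
  have himage : (fun m : L × ℕ => (m.1 +ᵥ x, m.2)) '' X = ψ '' (φ '' X) :=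
    (Set.image_image ψ φ X).symm
  rw [himage] at hfin ⊢
  refine (hasQuasiPolynomialCount_of_isSemilinearSet (δ := .snd _ ℕ) (hX.image φ) fun i => ?_).image
    0 hψ.injOn fun _ _ => rfl
  refine .of_finite_image ?_ hψ.injOn
  exact (hfin i).subset (Set.image_inter_subset ..|>.trans
    (Set.inter_subset_inter_right _ (Set.image_subset_iff.2 fun _ h => h)))

end OrbitCoordinates

namespace WeightedDigraph

section Ball

variable {V E : Type*} {Γ : WeightedDigraph V E} {U : Finset V} {x y : V} {i : ℕ}

theorem dist_le_coe_iff : Γ.dist x y ≤ i ↔ ∃ p, Γ.IsWalk x y p ∧ Γ.walkWeight p ≤ i := by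
  simp only [dist, ← ENat.lt_add_one_iff (ENat.natCast_ne_top i), iInf_lt_iff, exists_prop]
  simp only [ENat.lt_add_one_iff (ENat.natCast_ne_top i), Nat.cast_le]

theorem mem_ballAround_iff :
    y ∈ Γ.ballAround U i ↔ ∃ x ∈ U, ∃ p, Γ.IsWalk x y p ∧ Γ.walkWeight p ≤ i := by
  simp only [ballAround, Set.mem_ofPred_eq, ← ENat.lt_add_one_iff (ENat.natCast_ne_top i),
    iInf_lt_iff, exists_prop]
  simp only [ENat.lt_add_one_iff (ENat.natCast_ne_top i), dist_le_coe_iff]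

theorem walkWeight_append (p p' : List E) :
    Γ.walkWeight (p ++ p') = Γ.walkWeight p + Γ.walkWeight p' := by
  simp [walkWeight]

theorem IsWalk.concat {p : List E} {e : E} (hp : Γ.IsWalk x (Γ.src e) p) :
    Γ.IsWalk x (Γ.tgt e) (p ++ [e]) := by
  induction p generalizing x with
  | nil => exact ⟨hp.symm, rfl⟩
  | cons e' p ih => exact ⟨hp.1, ih hp.2⟩

theorem mem_ballAround_zero (hx : x ∈ U) : x ∈ Γ.ballAround U 0 :=
  mem_ballAround_iff.2 ⟨x, hx, [], rfl, le_rfl⟩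

theorem ballAround_mono {j : ℕ} (hij : i ≤ j) : Γ.ballAround U i ⊆ Γ.ballAround U j :=
  fun _ hy => le_trans (α := ℕ∞) hy (Nat.cast_le.2 hij)

theorem tgt_mem_ballAround {e : E} (he : Γ.src e ∈ Γ.ballAround U i) :
    Γ.tgt e ∈ Γ.ballAround U (i + Γ.weight e) := by
  obtain ⟨x, hx, p, hp, hw⟩ := mem_ballAround_iff.1 he
  refine mem_ballAround_iff.2 ⟨x, hx, p ++ [e], hp.concat, ?_⟩
  rw [walkWeight_append]
  exact add_le_add hw (by simp [walkWeight])

theorem ballAround_induction {P : ∀ y i, y ∈ Γ.ballAround U i → Prop}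
    (base : ∀ x (hx : x ∈ U), P x 0 (mem_ballAround_zero hx))
    (wait : ∀ y i hy, P y i hy → P y (i + 1) (ballAround_mono i.le_succ hy))
    (step : ∀ e i he, P (Γ.src e) i he → P (Γ.tgt e) (i + Γ.weight e) (tgt_mem_ballAround he))
    (hy : y ∈ Γ.ballAround U i) : P y i hy := by
  have along_walk (p : List E) (x : V) (k : ℕ) (hx : ∃ h, P x k h) (hp : Γ.IsWalk x y p) :
      ∃ h, P y (k + Γ.walkWeight p) h := by
    induction p generalizing x k with
    | nil => exact hp ▸ hx
    | cons e p ih =>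
      obtain ⟨rfl, hp⟩ := hp
      obtain ⟨h, hP⟩ := hx
      have := ih (Γ.tgt e) (k + Γ.weight e) ⟨_, step e k h hP⟩ hp
      rwa [add_assoc] at this
  obtain ⟨x, hx, p, hp, hw⟩ := mem_ballAround_iff.1 hy
  suffices h : ∃ h, P y i h from h.2
  refine Nat.le_induction ?_ (fun k _ ⟨h, hP⟩ => ⟨_, wait y k h hP⟩) i hw
  simpa only [zero_add] using along_walk p x 0 ⟨_, base x hx⟩ hp

theorem mem_or_exists_tgt_eq_of_mem_ballAround (hy : y ∈ Γ.ballAround U i) :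
    y ∈ U ∨ ∃ e, Γ.tgt e = y ∧ ∃ j < i, Γ.src e ∈ Γ.ballAround U j := by
  induction hy using ballAround_induction with
  | base x hx => exact .inl hx
  | wait y i _ h =>
    exact h.imp_right fun ⟨e, he, j, hj, hsrc⟩ => ⟨e, he, j, hj.trans i.lt_succ_self, hsrc⟩
  | step e i he =>
    exact .inr ⟨e, rfl, i, Nat.lt_add_of_pos_right (Γ.weight_pos e), he⟩

theorem finite_ballAround (hout : ∀ x, {e | Γ.src e = x}.Finite) (U : Finset V) (i : ℕ) :
    (Γ.ballAround U i).Finite := by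
  induction i using Nat.strong_induction_on with
  | _ i ih =>
    refine (U.finite_toSet.union ((Set.finite_Iio i).biUnion fun j hj =>
      (ih j hj).biUnion fun x _ => (hout x).image Γ.tgt)).subset fun y hy => ?_
    refine (mem_or_exists_tgt_eq_of_mem_ballAround hy).imp_right ?_
    rintro ⟨e, rfl, j, hj, hsrc⟩
    exact Set.mem_biUnion hj (Set.mem_biUnion hsrc ⟨e, rfl, rfl⟩)

end Ball

/-- The action of `L` on the vertices and the edges respects all the data of the graph. -/
structure IsInvariant {V E : Type*} (Γ : WeightedDigraph V E) (L : Type*) [AddCommGroup L]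
    [AddAction L V] [AddAction L E] : Prop where
  src_vadd : ∀ (u : L) (e : E), Γ.src (u +ᵥ e) = u +ᵥ Γ.src e
  tgt_vadd : ∀ (u : L) (e : E), Γ.tgt (u +ᵥ e) = u +ᵥ Γ.tgt e
  weight_vadd : ∀ (u : L) (e : E), Γ.weight (u +ᵥ e) = Γ.weight e

/-- The coordinates of the vertices of `U` that lie in the orbit `q`, with time `0`. -/
def startLabels {V : Type*} (L : Type*) [AddCommGroup L] [AddAction L V] (U : Finset V)
    (q : AddAction.orbitRel.Quotient L V) : Set (L × ℕ) :=
  {m | ∃ x ∈ U, orbitClass L x = q ∧ m = (displacement L x, 0)}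

/-- The displacements and weights of the edges from the representative of the orbit `q` to the
orbit `q'`. An additional label `(0, 1)` from each orbit to itself stands for waiting; it accounts
for the vertices that are reached before the time has run out. -/
def edgeLabels {V E : Type*} (Γ : WeightedDigraph V E) (L : Type*) [AddCommGroup L] [AddAction L V]
    (q q' : AddAction.orbitRel.Quotient L V) : Set (L × ℕ) :=
  {m | (∃ e, Γ.src e = q.out ∧ orbitClass L (Γ.tgt e) = q' ∧
    m = (displacement L (Γ.tgt e), Γ.weight e)) ∨ q = q' ∧ m = (0, 1)}

section Labels

variable {V E L : Type*} [AddCommGroup L] [AddAction L V]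
  {Γ : WeightedDigraph V E} {U : Finset V} {q : AddAction.orbitRel.Quotient L V}

theorem finite_startLabels (U : Finset V) (q : AddAction.orbitRel.Quotient L V) :
    (startLabels L U q).Finite := by
  refine (U.finite_toSet.image fun x => (displacement L x, 0)).subset ?_
  rintro _ ⟨x, hx, -, rfl⟩
  exact ⟨x, hx, rfl⟩

theorem finite_edgeLabels (hout : ∀ x, {e | Γ.src e = x}.Finite)
    (q q' : AddAction.orbitRel.Quotient L V) : (Γ.edgeLabels L q q').Finite := by
  refine (((hout q.out).image fun e => (displacement L (Γ.tgt e), Γ.weight e)).union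
    (Set.finite_singleton (0, 1))).subset ?_
  rintro _ (⟨e, he, -, rfl⟩ | ⟨-, rfl⟩)
  · exact .inl ⟨e, he, rfl⟩
  · exact .inr rfl

variable [AddAction L E]

theorem IsInvariant.vadd_out_mem_ballAround (hΓ : Γ.IsInvariant L) {m : L × ℕ}
    (hm : IsReachable (startLabels L U) (Γ.edgeLabels L) q m) :
    m.1 +ᵥ q.out ∈ Γ.ballAround U m.2 := by
  induction hm with
  | init hm =>
    obtain ⟨x, hx, rfl, rfl⟩ := hm
    rw [displacement_vadd_out]
    exact mem_ballAround_zero hx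
  | @step p q m a _ ha ih =>
    rcases ha with ⟨e, he, rfl, rfl⟩ | ⟨rfl, rfl⟩
    · rw [Prod.fst_add, add_vadd, displacement_vadd_out, ← hΓ.tgt_vadd, Prod.snd_add,
        ← hΓ.weight_vadd m.1]
      rw [← he, ← hΓ.src_vadd] at ih
      exact tgt_mem_ballAround ih
    · rw [Prod.fst_add, add_zero]
      exact ballAround_mono (Nat.le_add_right m.2 1) ih

theorem IsInvariant.exists_isReachable (hΓ : Γ.IsInvariant L) {y : V} {i : ℕ}
    (hy : y ∈ Γ.ballAround U i) : ∃ u : L, u +ᵥ (orbitClass L y).out = y ∧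
      IsReachable (startLabels L U) (Γ.edgeLabels L) (orbitClass L y) (u, i) := by
  induction hy using ballAround_induction with
  | base x hx => exact ⟨displacement L x, displacement_vadd_out L x, .init ⟨x, hx, rfl, rfl⟩⟩
  | wait y i _ h =>
    obtain ⟨u, hu, h⟩ := h
    refine ⟨u, hu, ?_⟩
    simpa using h.step (.inr ⟨rfl, rfl⟩)
  | step e i _ h =>
    obtain ⟨u, hu, h⟩ := h
    have tgt_eq : Γ.tgt (-u +ᵥ e) = -u +ᵥ Γ.tgt e := hΓ.tgt_vadd (-u) e
    have class_eq : orbitClass L (Γ.tgt (-u +ᵥ e)) = orbitClass L (Γ.tgt e) := by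
      rw [tgt_eq, orbitClass_vadd]
    have src_eq : Γ.src (-u +ᵥ e) = (orbitClass L (Γ.src e)).out := by
      rw [hΓ.src_vadd, neg_vadd_eq_iff, hu]
    have label_mem : (displacement L (Γ.tgt (-u +ᵥ e)), Γ.weight e) ∈
        Γ.edgeLabels L (orbitClass L (Γ.src e)) (orbitClass L (Γ.tgt e)) :=
      .inl ⟨-u +ᵥ e, src_eq, class_eq, by rw [hΓ.weight_vadd]⟩
    refine ⟨u + displacement L (Γ.tgt (-u +ᵥ e)), ?_, h.step label_mem⟩
    rw [add_vadd, ← class_eq, displacement_vadd_out, tgt_eq, vadd_neg_vadd]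

theorem IsInvariant.setOf_mem_ballAround_inter_orbit (hΓ : Γ.IsInvariant L)
    (q : AddAction.orbitRel.Quotient L V) :
    {z : V × ℕ | z.1 ∈ Γ.ballAround U z.2} ∩ (fun z => orbitClass L z.1) ⁻¹' {q} =
      (fun m : L × ℕ => (m.1 +ᵥ q.out, m.2)) ''
        {m | IsReachable (startLabels L U) (Γ.edgeLabels L) q m} := by
  ext ⟨y, i⟩
  constructor
  · rintro ⟨hy, rfl⟩
    obtain ⟨u, hu, h⟩ := hΓ.exists_isReachable hy
    exact ⟨(u, i), h, Prod.ext hu rfl⟩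
  · rintro ⟨m, hm, heq⟩
    obtain ⟨rfl, rfl⟩ := Prod.mk.inj heq
    exact ⟨hΓ.vadd_out_mem_ballAround hm, (orbitClass_vadd _ _).trans (orbitClass_out q)⟩

theorem setOf_mem_ballAround_inter_preimage_snd (U : Finset V) (i : ℕ) :
    {z : V × ℕ | z.1 ∈ Γ.ballAround U z.2} ∩ Prod.snd ⁻¹' {i} =
      (·, i) '' Γ.ballAround U i := by
  ext ⟨y, j⟩
  constructor
  · rintro ⟨hy, rfl⟩
    exact ⟨y, hy, rfl⟩
  · rintro ⟨y, hy, heq⟩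
    obtain ⟨rfl, rfl⟩ := Prod.mk.inj heq
    exact ⟨hy, rfl⟩

theorem IsInvariant.hasQuasiPolynomialCount_ballAround
    [Finite (AddAction.orbitRel.Quotient L V)] (hΓ : Γ.IsInvariant L)
    (hout : ∀ x, {e | Γ.src e = x}.Finite) (U : Finset V) :
    HasQuasiPolynomialCount Prod.snd {z : V × ℕ | z.1 ∈ Γ.ballAround U z.2} := by
  refine .of_fibers (fun z => orbitClass L z.1) fun q => ?_
  have hfin (i : ℕ) : ({z : V × ℕ | z.1 ∈ Γ.ballAround U z.2} ∩ (fun z => orbitClass L z.1) ⁻¹' {q}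
      ∩ Prod.snd ⁻¹' {i}).Finite := by
    refine ((finite_ballAround hout U i).image (·, i)).subset ?_
    rw [← setOf_mem_ballAround_inter_preimage_snd]
    exact Set.inter_subset_inter_left _ Set.inter_subset_left
  rw [hΓ.setOf_mem_ballAround_inter_orbit] at hfin ⊢
  refine hasQuasiPolynomialCount_image_vadd q.out ?_ hfin
  exact IsReachable.isSemilinearSet_of_finite Set.finite_univ
    (fun q => .of_finite (finite_startLabels U q))
    (fun p q => .of_finite (finite_edgeLabels hout p q)) (fun p hp => absurd (Set.mem_univ p) hp) q

theorem IsPeriodic.isInvariant {n : ℕ} (hΓ : Γ.IsPeriodic L n) : Γ.IsInvariant L :=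
  ⟨hΓ.src_vadd, hΓ.tgt_vadd, hΓ.weight_vadd⟩

theorem IsPeriodic.finite_out {n : ℕ} (hΓ : Γ.IsPeriodic L n) (x : V) :
    {e | Γ.src e = x}.Finite := by
  have := hΓ.finite_edges
  refine .of_finite_image (f := orbitClass L) (Set.toFinite _) fun e he e' he' h => ?_
  obtain ⟨u, rfl⟩ : ∃ u : L, u +ᵥ e' = e := AddAction.orbitRel_apply.1 (Quotient.exact h)
  have hu : u +ᵥ x = x := by
    rw [Set.mem_ofPred_eq, hΓ.src_vadd] at he
    rw [Set.mem_ofPred_eq] at he'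
    rwa [he'] at he
  rw [hΓ.free_vertices u x hu, zero_vadd]

end Labels

end WeightedDigraph

theorem theoremA5_general {V E L : Type*} [AddCommGroup L] [AddAction L V] [AddAction L E]
    [Finite (AddAction.orbitRel.Quotient L V)] (Γ : WeightedDigraph V E) (hΓ : Γ.IsInvariant L)
    (hout : ∀ x, {e | Γ.src e = x}.Finite) (U : Finset V) :
    (∀ i : ℕ, (Γ.ballAround U i).Finite) ∧
      IsQuasiPolynomialType (fun i : ℕ => ((Γ.ballAround U i).ncard : ℂ)) := by
  refine ⟨WeightedDigraph.finite_ballAround hout U, ?_⟩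
  have hcount := (hΓ.hasQuasiPolynomialCount_ballAround hout U).isShiftQuasiPolynomial
  simp only [WeightedDigraph.setOf_mem_ballAround_inter_preimage_snd,
    Set.ncard_image_of_injective _ (Prod.mk_left_injective _)] at hcount
  exact hcount.isQuasiPolynomialType

theorem theoremA5 {V E L : Type*} [AddCommGroup L] [AddAction L V] [AddAction L E]
    (Γ : WeightedDigraph V E) (n : ℕ) (hΓ : Γ.IsPeriodic L n) (U : Finset V) :
    (∀ i : ℕ, (Γ.ballAround U i).Finite) ∧
      IsQuasiPolynomialType (fun i : ℕ => ((Γ.ballAround U i).ncard : ℂ)) := by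
  have := hΓ.finite_vertices
  exact theoremA5_general Γ hΓ.isInvariant hΓ.finite_out U
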